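/- Let $\Gamma$ be a countable discrete amenable group, let $\Gamma\curvearrowright Y$ be a continuous action on a compact metrizable space, and let $\Gamma\curvearrowright G$ be an algebraic action, i.e. $G$ is a compact metrizable group on which $\Gamma$ acts by continuous automorphisms. Let $\sigma\colon\Gamma\times Y\to G$ be a continuous cocycle, i.e. a continuous map with $\sigma(st,y)=\sigma(s,ty)\cdot s(\sigma(t,y))$ for all $s,t\in\Gamma$, $y\in Y$. Let $Y\times_\sigma G$ be the space $Y\times G$ with the $\Gamma$-action $s(y,g)=(sy,\sigma(s,y)\cdot (sg))$, and let $\pi\colon Y\times_\sigma G\to Y$ be the projection. Fix a Følner sequence $(F_n)_n$ of $\Gamma$, i.e. nonempty finite sets $F_n\subseteq\Gamma$ with $|sF_n\Delta F_n|/|F_n|\to0$ for every $s\in\Gamma$. Then $$\operatorname{mdim}(Y\times_\sigma G)\le \operatorname{mdim}(Y)+\sup_{y\in Y}\operatorname{mdim}(\pi^{-1}(y)).$$ Here, for a finite open cover $\mathcal U$ of a space, $\mathcal D(\mathcal U)$ is the least value of $\operatorname{ord}(\mathcal W)=\max_x\sum_{W\in\mathcal W}1_W(x)-1$ over the finite open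 covers $\mathcal W$ refining $\mathcal U$. For a continuous action of $\Gamma$ on a compact metrizable space $X$, a finite open cover $\mathcal U$ of $X$ and a finite set $F\subseteq\Gamma$, $\mathcal U^F=\bigvee_{s\in F}s^{-1}\mathcal U$. The mean dimension of $X$ is $\operatorname{mdim}(X)=\sup_{\mathcal U}\lim_F \mathcal D(\mathcal U^F)/|F|\in[0,\infty]$, where $\mathcal U$ runs over the finite open covers of $X$ and the limit (which exists by the Ornstein–Weiss lemma) is taken as the nonempty finite set $F\subseteq\Gamma$ becomes more and more invariant, i.e. along the net of pairs $(K,\delta)$, with $K\subseteq\Gamma$ nonempty finite and $\delta>0$, and the sets $F$ with $|\{t\in F: Kt\subseteq F\}|\ge(1-\delta)|F|$. The mean dimension of a closed subset $K\subseteq X$ is $\operatorname{mdim}(K)=\sup_{\mathcal U}\limsup_{n\to\infty}\mathcal D(\mathcal U^{F_n}|_K)/|F_n|$, where $\mathcal U$ runs over the finite open covers of $X$ and $\mathcal U|_K=\{U\cap K:U\in\mathcal U\}$ is viewed as an open cover of $K$. -/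

import Mathlib

open Filter Topology
open scoped ENNReal

namespace MeanDim

noncomputable section

/-! ### Amenable groups -/

section Amenable

variable {Γ : Type*} [Group Γ]

/-- The set `𝓑(K, δ)` of nonempty finite `F ⊆ Γ` with `|{t ∈ F : K t ⊆ F}| ≥ (1 - δ) |F|`. -/
def almostInvariant (K : Finset Γ) (δ : ℝ) : Set (Finset Γ) :=
  {F | F.Nonempty ∧
    (1 - δ) * (F.card : ℝ) ≤ ({t : Γ | t ∈ F ∧ ∀ k ∈ K, k * t ∈ F}.ncard : ℝ)}

variable (Γ) in
/-- `Γ` is amenable: every `𝓑(K, δ)` is nonempty. -/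
def IsAmenable : Prop :=
  ∀ (K : Finset Γ) (δ : ℝ), K.Nonempty → 0 < δ → (almostInvariant K δ).Nonempty

variable (Γ) in
/-- The filter "as `F` becomes more and more invariant" on the finite subsets of `Γ`; it is
generated by the sets `𝓑(K, δ)`, `K` nonempty finite, `δ > 0`. -/
def invariantFilter : Filter (Finset Γ) :=
  ⨅ (K : Finset Γ) (_ : K.Nonempty) (δ : ℝ) (_ : 0 < δ), 𝓟 (almostInvariant K δ)

/-- A (left) Følner sequence: nonempty finite sets with `|s Fₙ ∆ Fₙ| / |Fₙ| → 0` for all `s`. -/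
structure IsFolnerSeq (F : ℕ → Finset Γ) : Prop where
  nonempty : ∀ n, (F n).Nonempty
  tendsto : ∀ s : Γ,
    Tendsto (fun n => ((symmDiff ((fun t => s * t) '' (F n : Set Γ)) (F n : Set Γ)).ncard : ℝ)
      / ((F n).card : ℝ)) atTop (𝓝 0)

end Amenable

/-! ### Finite open covers -/

section Covers

variable {X : Type*}

/-- `𝒰` is a finite open cover of `X`. -/
structure IsFinOpenCover [TopologicalSpace X] (𝒰 : Set (Set X)) : Prop where
  finite : 𝒰.Finite
  isOpen : ∀ U ∈ 𝒰, IsOpen U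
  covers : ⋃₀ 𝒰 = Set.univ

/-- `𝒲` refines `𝒰`: every member of `𝒲` is contained in some member of `𝒰`. -/
def Refines (𝒲 𝒰 : Set (Set X)) : Prop :=
  ∀ W ∈ 𝒲, ∃ U ∈ 𝒰, W ⊆ U

/-- The overlapping number `max_x ∑_{U ∈ 𝒰} 1_U(x) - 1`. -/
def ord (𝒰 : Set (Set X)) : ℕ∞ :=
  (⨆ x : X, {U | U ∈ 𝒰 ∧ x ∈ U}.encard) - 1

/-- `𝒟(𝒰)`: the least `ord 𝒲` over the finite open covers `𝒲` refining `𝒰`. -/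
def coverDim [TopologicalSpace X] (𝒰 : Set (Set X)) : ℕ∞ :=
  ⨅ (𝒲 : Set (Set X)) (_ : IsFinOpenCover 𝒲 ∧ Refines 𝒲 𝒰), ord 𝒲

/-- The join `𝒰^F = ⋁_{s ∈ F} s⁻¹ 𝒰`. -/
def joinCover {Γ : Type*} [Group Γ] [MulAction Γ X] (𝒰 : Set (Set X)) (F : Finset Γ) :
    Set (Set X) :=
  {V | ∃ u : Γ → Set X, (∀ s ∈ F, u s ∈ 𝒰) ∧ V = ⋂ s ∈ F, (fun x : X => s • x) ⁻¹' u s}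

/-- The restriction `𝒰|_K = {U ∩ K : U ∈ 𝒰}`, as a family of subsets of the subspace `K`. -/
def restrictCover (𝒰 : Set (Set X)) (K : Set X) : Set (Set K) :=
  (fun U : Set X => (Subtype.val : K → X) ⁻¹' U) '' 𝒰

end Covers

/-! ### Mean dimension -/

section MeanDimension

/-- The mean dimension `mdim(X) = sup_𝒰 lim_F 𝒟(𝒰^F) / |F|` of the system `Γ ↷ X`, with `𝒰`
ranging over the finite open covers of `X` and `F` becoming more and more invariant. For a
continuous action of an amenable group the limit exists by the Ornstein–Weiss lemma, so it agrees
with the upper limit that is used here. -/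
def mdim (Γ : Type*) [Group Γ] (X : Type*) [TopologicalSpace X] [MulAction Γ X] : ℝ≥0∞ :=
  ⨆ (𝒰 : Set (Set X)) (_ : IsFinOpenCover 𝒰),
    limsup (fun F : Finset Γ => (coverDim (joinCover 𝒰 F) : ℝ≥0∞) / (F.card : ℝ≥0∞))
      (invariantFilter Γ)

/-- The mean dimension `sup_𝒰 limsup_n 𝒟(𝒰^{Fₙ}|_K) / |Fₙ|` of a subset `K` of the system
`Γ ↷ X` along the sequence `Fₙ`, with `𝒰` ranging over the finite open covers of `X`. -/
def mdimOn {Γ : Type*} [Group Γ] {X : Type*} [TopologicalSpace X] [MulAction Γ X]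
    (F : ℕ → Finset Γ) (K : Set X) : ℝ≥0∞ :=
  ⨆ (𝒰 : Set (Set X)) (_ : IsFinOpenCover 𝒰),
    limsup (fun n : ℕ => (coverDim (restrictCover (joinCover 𝒰 (F n)) K) : ℝ≥0∞)
      / ((F n).card : ℝ≥0∞)) atTop

end MeanDimension

/-! ### Cocycles and skew products -/

section Skew

/-- A continuous cocycle `σ : Γ × Y → G`, with `σ(st, y) = σ(s, ty) · s(σ(t, y))`. As `Γ` is
discrete, continuity on `Γ × Y` is continuity of every `σ(s, ·)`. -/
structure Cocycle (Γ Y G : Type*) [Group Γ] [TopologicalSpace Y] [MulAction Γ Y]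
    [Group G] [TopologicalSpace G] [MulDistribMulAction Γ G] where
  toFun : Γ → Y → G
  continuous_toFun : ∀ s, Continuous (toFun s)
  map_mul : ∀ (s t : Γ) (y : Y), toFun (s * t) y = toFun s (t • y) * s • toFun t y

variable {Γ Y G : Type*} [Group Γ] [TopologicalSpace Y] [MulAction Γ Y]
  [Group G] [TopologicalSpace G] [MulDistribMulAction Γ G]

theorem Cocycle.map_one (σ : Cocycle Γ Y G) (y : Y) : σ.toFun 1 y = 1 := by
  have h := σ.map_mul 1 1 y
  simpa using h

/-- The underlying space `Y × G` of the skew product `Y ×_σ G`. -/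
def SkewProduct (_σ : Cocycle Γ Y G) : Type _ := Y × G

namespace SkewProduct

variable (σ : Cocycle Γ Y G)

instance : TopologicalSpace (SkewProduct σ) :=
  inferInstanceAs (TopologicalSpace (Y × G))

instance [CompactSpace Y] [CompactSpace G] : CompactSpace (SkewProduct σ) :=
  inferInstanceAs (CompactSpace (Y × G))

instance [TopologicalSpace.MetrizableSpace Y] [TopologicalSpace.MetrizableSpace G] :
    TopologicalSpace.MetrizableSpace (SkewProduct σ) :=
  inferInstanceAs (TopologicalSpace.MetrizableSpace (Y × G))

/-- The action `s (y, g) = (s y, σ(s, y) · (s g))`. -/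
instance : MulAction Γ (SkewProduct σ) where
  smul s p := ((s • p.1, σ.toFun s p.1 * s • p.2) : Y × G)
  one_smul p := by
    change ((_, _) : Y × G) = p
    rw [one_smul, one_smul, σ.map_one, one_mul]
    rfl
  mul_smul s t p := by
    change ((_, _) : Y × G) = (s • t • p.1, σ.toFun s (t • p.1) * s • (σ.toFun t p.1 * t • p.2))
    rw [σ.map_mul, mul_smul, mul_smul, smul_mul', mul_assoc]

instance [IsTopologicalGroup G] [ContinuousConstSMul Γ Y] [ContinuousConstSMul Γ G] :
    ContinuousConstSMul Γ (SkewProduct σ) where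
  continuous_const_smul s := by
    change Continuous fun p : Y × G => ((s • p.1, σ.toFun s p.1 * s • p.2) : Y × G)
    have := σ.continuous_toFun s
    fun_prop

/-- The factor map `π : Y ×_σ G → Y`. -/
def proj (p : SkewProduct σ) : Y := Prod.fst (α := Y) (β := G) p

end SkewProduct

end Skew

end

end MeanDim

/-!
`𝒟` is subadditive under joins: stack the values at `x` of partitions of unity subordinate to two
covers into two subdivisions of `[0, 1]`. The pairs of intervals that overlap define a cover
refining the join, and two subdivisions into `a` and `b` intervals have at most `a + b - 1`
overlapping pairs.

All fibres of the skew product look alike once the base coordinate is known: the fibre coordinate of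
`s (z, g)` is `σ(s, z) σ(s, y)⁻¹` times that of `s (y, g)`. Hence `𝒰^T` is refined by the join of
`𝒲^T`, read off on a single fibre, with a cover `𝒱` of `Y`, where `𝒱` depends on the finite set
`T ⊆ Γ` but `𝒲` does not. By the Ornstein–Weiss quasi-tiling theorem, a sufficiently
invariant `A ⊆ Γ` is covered, up to a small proportion, by almost disjoint translates `F n * c` of
finitely many sets of the Følner sequence; one `𝒱`, made for their union `T`, serves for all `A`. In
`𝒟(𝒰^A)`, the base contributes `𝒟(𝒱^A)`, each tile contributes at most its cardinality times the
mean dimension of the fibre, up to a small error, and the uncovered part is negligible.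
-/

namespace MeanDim

open Set
open scoped NNReal

/-! ### Overlaps of two subdivisions of an interval -/

section StackedIntervals

variable {ι κ : Type*} [Fintype ι] [LinearOrder ι] [Fintype κ] [LinearOrder κ]

/-- The left end point of the `i`-th interval when intervals of lengths `φ j` are stacked from `0`
upwards in the order of their indices. -/
def leftEnd (φ : ι → ℝ) (i : ι) : ℝ := ∑ j with j < i, φ j

theorem leftEnd_add_le_of_lt {φ : ι → ℝ} (hφ : 0 ≤ φ) {i j : ι} (hij : i < j) :
    leftEnd φ i + φ i ≤ leftEnd φ j := by
  rw [leftEnd, add_comm, ← Finset.sum_insert (by simp)]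
  refine Finset.sum_le_sum_of_subset_of_nonneg (fun k hk => ?_) fun k _ _ => hφ k
  rcases Finset.mem_insert.1 hk with rfl | hk
  · simpa using hij
  · simpa using (Finset.mem_filter.1 hk).2.trans hij

theorem eq_of_mem_Ico_leftEnd {φ : ι → ℝ} (hφ : 0 ≤ φ) {t : ℝ} {i j : ι}
    (hi : t ∈ Ico (leftEnd φ i) (leftEnd φ i + φ i))
    (hj : t ∈ Ico (leftEnd φ j) (leftEnd φ j + φ j)) : i = j := by
  rcases lt_trichotomy i j with hij | hij | hij
  · linarith [leftEnd_add_le_of_lt hφ hij, hi.2, hj.1]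
  · exact hij
  · linarith [leftEnd_add_le_of_lt hφ hij, hi.1, hj.2]

theorem exists_pos_and_leftEnd_eq_zero {φ : ι → ℝ} (hφ : 0 < φ) :
    ∃ i, 0 < φ i ∧ leftEnd φ i = 0 := by
  obtain ⟨hφ0, hφpos⟩ := Pi.lt_def.1 hφ
  obtain ⟨i, hi, hmin⟩ := WellFounded.has_min (wellFounded_lt (α := ι)) {i | 0 < φ i} hφpos
  exact ⟨i, hi, Finset.sum_eq_zero fun j hj =>
    (not_lt.1 fun hpos => hmin j hpos (Finset.mem_filter.1 hj).2).antisymm (hφ0 j)⟩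

/-- The `p.1`-th interval stacked with lengths `φ` and the `p.2`-th interval stacked with lengths
`ψ` overlap in an interval of positive length. -/
def Overlap (φ : ι → ℝ) (ψ : κ → ℝ) (p : ι × κ) : Prop :=
  max (leftEnd φ p.1) (leftEnd ψ p.2) < min (leftEnd φ p.1 + φ p.1) (leftEnd ψ p.2 + ψ p.2)

theorem Overlap.pos_left {φ : ι → ℝ} {ψ : κ → ℝ} {p : ι × κ} (h : Overlap φ ψ p) : 0 < φ p.1 :=
  lt_add_iff_pos_right _ |>.1 <| (le_max_left _ _).trans_lt <| h.trans_le (min_le_left _ _)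

theorem Overlap.pos_right {φ : ι → ℝ} {ψ : κ → ℝ} {p : ι × κ} (h : Overlap φ ψ p) : 0 < ψ p.2 :=
  lt_add_iff_pos_right _ |>.1 <| (le_max_right _ _).trans_lt <| h.trans_le (min_le_right _ _)

theorem exists_overlap {φ : ι → ℝ} {ψ : κ → ℝ} (hφ : 0 < φ) (hψ : 0 < ψ) :
    ∃ p, Overlap φ ψ p := by
  obtain ⟨i, hi, hi0⟩ := exists_pos_and_leftEnd_eq_zero hφ
  obtain ⟨j, hj, hj0⟩ := exists_pos_and_leftEnd_eq_zero hψ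
  exact ⟨(i, j), by simp [Overlap, hi, hj, hi0, hj0]⟩

-- An overlap is determined by its left end point, which is a left end point of one of its two
-- intervals; and `0` is a left end point for both `φ` and `ψ`.
theorem encard_overlap_add_one_le {φ : ι → ℝ} {ψ : κ → ℝ} (hφ : 0 < φ) (hψ : 0 < ψ) :
    {p | Overlap φ ψ p}.encard + 1 ≤ {i | 0 < φ i}.encard + {j | 0 < ψ j}.encard := by
  set S := leftEnd φ '' {i | 0 < φ i}
  set T := leftEnd ψ '' {j | 0 < ψ j}
  let start : ι × κ → ℝ := fun p => max (leftEnd φ p.1) (leftEnd ψ p.2)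
  have start_mem : MapsTo start {p | Overlap φ ψ p} (S ∪ T) := fun p hp => by
    rcases max_choice (leftEnd φ p.1) (leftEnd ψ p.2) with h | h
    · exact Or.inl ⟨p.1, hp.pos_left, h.symm⟩
    · exact Or.inr ⟨p.2, hp.pos_right, h.symm⟩
  have mem_left : ∀ p, Overlap φ ψ p →
      start p ∈ Ico (leftEnd φ p.1) (leftEnd φ p.1 + φ p.1) :=
    fun p hp => ⟨le_max_left _ _, hp.trans_le (min_le_left _ _)⟩
  have mem_right : ∀ p, Overlap φ ψ p →
      start p ∈ Ico (leftEnd ψ p.2) (leftEnd ψ p.2 + ψ p.2) :=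
    fun p hp => ⟨le_max_right _ _, hp.trans_le (min_le_right _ _)⟩
  have start_injOn : InjOn start {p | Overlap φ ψ p} := fun p hp q hq hpq =>
    Prod.ext (eq_of_mem_Ico_leftEnd hφ.le (mem_left p hp) (hpq ▸ mem_left q hq))
      (eq_of_mem_Ico_leftEnd hψ.le (mem_right p hp) (hpq ▸ mem_right q hq))
  have zero_mem : (S ∩ T).Nonempty := by
    obtain ⟨i, hi, hi0⟩ := exists_pos_and_leftEnd_eq_zero hφ
    obtain ⟨j, hj, hj0⟩ := exists_pos_and_leftEnd_eq_zero hψ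
    exact ⟨0, ⟨i, hi, hi0⟩, ⟨j, hj, hj0⟩⟩
  calc {p | Overlap φ ψ p}.encard + 1 ≤ (S ∪ T).encard + (S ∩ T).encard := by
        gcongr
        · exact encard_le_encard_of_injOn start_mem start_injOn
        · exact one_le_encard_iff_nonempty.2 zero_mem
    _ = S.encard + T.encard := encard_union_add_encard_inter S T
    _ ≤ {i | 0 < φ i}.encard + {j | 0 < ψ j}.encard := by
        gcongr <;> exact encard_image_le _ _

end StackedIntervals

/-! ### Joins of covers -/

section Covers

variable {X Z : Type*} {𝒰 𝒱 𝒲 : Set (Set X)}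

theorem Refines.refl (𝒰 : Set (Set X)) : Refines 𝒰 𝒰 := fun U hU => ⟨U, hU, subset_rfl⟩

theorem Refines.trans (h𝒲 : Refines 𝒲 𝒱) (h𝒱 : Refines 𝒱 𝒰) : Refines 𝒲 𝒰 := fun W hW =>
  let ⟨V, hV, hWV⟩ := h𝒲 W hW
  let ⟨U, hU, hVU⟩ := h𝒱 V hV
  ⟨U, hU, hWV.trans hVU⟩

theorem Refines.preimage (h : Refines 𝒱 𝒰) (f : Z → X) :
    Refines (Set.preimage f '' 𝒱) (Set.preimage f '' 𝒰) := by
  rintro _ ⟨V, hV, rfl⟩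
  obtain ⟨U, hU, hVU⟩ := h V hV
  exact ⟨_, mem_image_of_mem _ hU, preimage_mono hVU⟩

/-- The join `𝒰 ∨ 𝒱` of two covers. -/
def join (𝒰 𝒱 : Set (Set X)) : Set (Set X) := image2 (· ∩ ·) 𝒰 𝒱

theorem join_refines_left (𝒰 𝒱 : Set (Set X)) : Refines (join 𝒰 𝒱) 𝒰 := by
  rintro _ ⟨U, hU, V, -, rfl⟩
  exact ⟨U, hU, inter_subset_left⟩

theorem join_refines_right (𝒰 𝒱 : Set (Set X)) : Refines (join 𝒰 𝒱) 𝒱 := by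
  rintro _ ⟨U, -, V, hV, rfl⟩
  exact ⟨V, hV, inter_subset_right⟩

theorem preimage_image_join (f : Z → X) (𝒰 𝒱 : Set (Set X)) :
    Set.preimage f '' join 𝒰 𝒱 = join (Set.preimage f '' 𝒰) (Set.preimage f '' 𝒱) :=
  image_image2_distrib fun _ _ => preimage_inter

theorem Refines.join (h𝒰 : Refines 𝒲 𝒰) (h𝒱 : Refines 𝒲 𝒱) : Refines 𝒲 (join 𝒰 𝒱) := by
  intro W hW
  obtain ⟨U, hU, hWU⟩ := h𝒰 W hW
  obtain ⟨V, hV, hWV⟩ := h𝒱 W hW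
  exact ⟨U ∩ V, mem_image2_of_mem hU hV, subset_inter hWU hWV⟩

/-- The join `⋁_{i ∈ s} 𝒰 i` of a finite family of covers; the values of `u` outside `s` are
irrelevant. -/
def finJoin {ι : Type*} (s : Finset ι) (𝒰 : ι → Set (Set X)) : Set (Set X) :=
  {W | ∃ u : ι → Set X, (∀ i ∈ s, u i ∈ 𝒰 i) ∧ W = ⋂ i ∈ s, u i}

section FinJoin

variable {ι : Type*} {s : Finset ι} {𝒰 : ι → Set (Set X)}

theorem finJoin_refines {i : ι} (hi : i ∈ s) : Refines (finJoin s 𝒰) (𝒰 i) := by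
  rintro _ ⟨u, hu, rfl⟩
  exact ⟨u i, hu i hi, biInter_subset_of_mem hi⟩

theorem refines_finJoin_iff : Refines 𝒲 (finJoin s 𝒰) ↔ ∀ i ∈ s, Refines 𝒲 (𝒰 i) := by
  refine ⟨fun h i hi => h.trans (finJoin_refines hi), fun h W hW => ?_⟩
  choose! u hu hWu using fun i hi => h i hi W hW
  exact ⟨_, ⟨u, hu, rfl⟩, subset_iInter₂ hWu⟩

theorem IsFinOpenCover.finJoin [TopologicalSpace X] (h : ∀ i ∈ s, IsFinOpenCover (𝒰 i)) :
    IsFinOpenCover (finJoin s 𝒰) where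
  finite := by
    have hfin : (univ.pi fun i : s => 𝒰 i).Finite := Finite.pi fun i => (h i i.2).finite
    refine (hfin.image fun v => ⋂ i, v i).subset ?_
    rintro _ ⟨u, hu, rfl⟩
    exact ⟨fun i => u i, fun i _ => hu i i.2, iInter_subtype _ _⟩
  isOpen := by
    rintro _ ⟨u, hu, rfl⟩
    exact isOpen_biInter_finset fun i hi => (h i hi).isOpen _ (hu i hi)
  covers := by
    refine eq_univ_of_forall fun x => ?_
    have hpoint : Refines {{x}} (MeanDim.finJoin s 𝒰) := refines_finJoin_iff.2 fun i hi => by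
      rintro _ rfl
      simpa using mem_sUnion.1 ((h i hi).covers ▸ mem_univ x)
    simpa using hpoint {x} rfl

end FinJoin

section JoinCover

variable {Γ : Type*} [Group Γ] [MulAction Γ X] {A : Finset Γ}

theorem joinCover_eq_finJoin (𝒰 : Set (Set X)) (A : Finset Γ) :
    joinCover 𝒰 A = finJoin A fun s => Set.preimage (s • ·) '' 𝒰 := by
  ext W
  constructor
  · rintro ⟨u, hu, rfl⟩
    exact ⟨_, fun s hs => mem_image_of_mem _ (hu s hs), rfl⟩
  · rintro ⟨v, hv, rfl⟩
    choose! u hu huv using hv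
    exact ⟨u, hu, iInter₂_congr fun s hs => (huv s hs).symm⟩

theorem refines_joinCover_iff :
    Refines 𝒲 (joinCover 𝒰 A) ↔ ∀ s ∈ A, Refines 𝒲 (Set.preimage (s • ·) '' 𝒰) := by
  rw [joinCover_eq_finJoin, refines_finJoin_iff]

theorem joinCover_refines {s : Γ} (hs : s ∈ A) :
    Refines (joinCover 𝒰 A) (Set.preimage (s • ·) '' 𝒰) :=
  refines_joinCover_iff.1 (.refl _) s hs

end JoinCover

end Covers

/-! ### Subadditivity of `𝒟` under joins -/

section CoverDim

variable {X Z : Type*} {𝒰 𝒱 𝒲 : Set (Set X)}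

theorem ord_le_iff {k : ℕ∞} : ord 𝒰 ≤ k ↔ ∀ x, {U | U ∈ 𝒰 ∧ x ∈ U}.encard ≤ k + 1 := by
  rw [ord, tsub_le_iff_right, iSup_le_iff]

theorem encard_mem_le_ord_add_one (𝒰 : Set (Set X)) (x : X) :
    {U | U ∈ 𝒰 ∧ x ∈ U}.encard ≤ ord 𝒰 + 1 :=
  ord_le_iff.1 le_rfl x

theorem encard_pos_le_ord_add_one {φ : 𝒰 → ℝ} {x : X} (h : ∀ U, 0 < φ U → x ∈ U.1) :
    {U | 0 < φ U}.encard ≤ ord 𝒰 + 1 := by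
  have hmaps : MapsTo Subtype.val {U | 0 < φ U} {U | U ∈ 𝒰 ∧ x ∈ U} :=
    fun U hU => ⟨U.2, h U hU⟩
  exact (encard_le_encard_of_injOn hmaps Subtype.val_injective.injOn).trans
    (encard_mem_le_ord_add_one 𝒰 x)

theorem ord_preimage_le (f : Z → X) (𝒰 : Set (Set X)) : ord (Set.preimage f '' 𝒰) ≤ ord 𝒰 := by
  refine ord_le_iff.2 fun z => le_trans ?_ (encard_mem_le_ord_add_one 𝒰 (f z))
  refine (encard_le_encard ?_).trans (encard_image_le (Set.preimage f) _)
  rintro _ ⟨⟨U, hU, rfl⟩, hz⟩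
  exact ⟨U, ⟨hU, hz⟩, rfl⟩

variable [TopologicalSpace X] [TopologicalSpace Z]

theorem IsFinOpenCover.coverDim_le_ord (h𝒲 : IsFinOpenCover 𝒲) (h : Refines 𝒲 𝒰) :
    coverDim 𝒰 ≤ ord 𝒲 :=
  iInf₂_le 𝒲 ⟨h𝒲, h⟩

theorem coverDim_le_of_refines (h : Refines 𝒱 𝒰) : coverDim 𝒰 ≤ coverDim 𝒱 :=
  le_iInf₂ fun _ h𝒲 => h𝒲.1.coverDim_le_ord (h𝒲.2.trans h)

theorem IsFinOpenCover.coverDim_ne_top (h : IsFinOpenCover 𝒰) : coverDim 𝒰 ≠ ⊤ := by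
  refine ne_top_of_le_ne_top h.finite.encard_lt_top.ne
    ((h.coverDim_le_ord (.refl 𝒰)).trans (ord_le_iff.2 fun x => ?_))
  exact (encard_le_encard (sep_subset _ _)).trans le_self_add

theorem IsFinOpenCover.preimage {f : Z → X} (hf : Continuous f) (h : IsFinOpenCover 𝒰) :
    IsFinOpenCover (Set.preimage f '' 𝒰) where
  finite := h.finite.image _
  isOpen := by
    rintro _ ⟨U, hU, rfl⟩
    exact (h.isOpen U hU).preimage hf
  covers := by rw [sUnion_image, ← preimage_iUnion₂, ← sUnion_eq_biUnion, h.covers, preimage_univ]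

theorem coverDim_preimage_le {f : Z → X} (hf : Continuous f) (𝒰 : Set (Set X)) :
    coverDim (Set.preimage f '' 𝒰) ≤ coverDim 𝒰 :=
  le_iInf₂ fun 𝒲 h𝒲 =>
    ((h𝒲.1.preimage hf).coverDim_le_ord (h𝒲.2.preimage f)).trans (ord_preimage_le f 𝒲)

theorem IsFinOpenCover.exists_partitionOfUnity [NormalSpace X] (h : IsFinOpenCover 𝒰) :
    ∃ f : PartitionOfUnity 𝒰 X, ∀ U x, 0 < f U x → x ∈ U.1 := by
  have := h.finite.to_subtype
  obtain ⟨f, hf⟩ := PartitionOfUnity.exists_isSubordinate_of_locallyFinite isClosed_univ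
    (fun U : 𝒰 => U.1) (fun U => h.isOpen U U.2) (locallyFinite_of_finite _)
    (by rw [← sUnion_eq_iUnion, h.covers])
  exact ⟨f, fun U x hx => hf U (subset_tsupport _ hx.ne')⟩

theorem partitionOfUnity_pos {ι : Type*} (f : PartitionOfUnity ι X) (x : X) : 0 < (f · x) :=
  Pi.lt_def.2 ⟨fun i => f.nonneg i x, f.exists_pos (mem_univ x)⟩

section OverlapCover

variable {ι κ : Type*} [Fintype ι] [LinearOrder ι] [Fintype κ] [LinearOrder κ]
  (f : PartitionOfUnity ι X) (g : PartitionOfUnity κ X)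

/-- The cover by the sets of all `x` at which two given intervals overlap, when the values at `x`
of the partitions of unity `f` and `g` are stacked into two subdivisions of `[0, 1]`. -/
def overlapCover : Set (Set X) := range fun p => {x | Overlap (f · x) (g · x) p}

theorem continuous_leftEnd (i : ι) : Continuous fun x => leftEnd (f · x) i :=
  continuous_finsetSum _ fun j _ => (f j).continuous

theorem isFinOpenCover_overlapCover : IsFinOpenCover (overlapCover f g) where
  finite := finite_range _
  isOpen := by
    rintro _ ⟨⟨i, j⟩, rfl⟩
    have := continuous_leftEnd f i
    have := continuous_leftEnd g j
    have := (f i).continuous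
    have := (g j).continuous
    exact isOpen_lt (by fun_prop) (by fun_prop)
  covers := by
    refine eq_univ_of_forall fun x => ?_
    obtain ⟨p, hp⟩ := exists_overlap (partitionOfUnity_pos f x) (partitionOfUnity_pos g x)
    exact ⟨_, mem_range_self p, hp⟩

theorem ord_overlapCover_le {m n : ℕ∞} (hf : ∀ x, {i | 0 < f i x}.encard ≤ m + 1)
    (hg : ∀ x, {j | 0 < g j x}.encard ≤ n + 1) : ord (overlapCover f g) ≤ m + n := by
  refine ord_le_iff.2 fun x => ?_
  have hcover : {U | U ∈ overlapCover f g ∧ x ∈ U}.encard ≤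
      {p | Overlap (f · x) (g · x) p}.encard := by
    refine (encard_le_encard ?_).trans
      (encard_image_le (fun p => {x | Overlap (f · x) (g · x) p}) _)
    rintro _ ⟨⟨p, rfl⟩, hp⟩
    exact ⟨p, hp, rfl⟩
  refine (ENat.add_le_add_iff_right ENat.one_ne_top).1 ?_
  calc {U | U ∈ overlapCover f g ∧ x ∈ U}.encard + 1
      ≤ {p | Overlap (f · x) (g · x) p}.encard + 1 := by gcongr
    _ ≤ {i | 0 < f i x}.encard + {j | 0 < g j x}.encard :=
        encard_overlap_add_one_le (partitionOfUnity_pos f x) (partitionOfUnity_pos g x)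
    _ ≤ (m + 1) + (n + 1) := add_le_add (hf x) (hg x)
    _ = m + n + 1 + 1 := by ring

end OverlapCover

theorem coverDim_join_le_ord_add_ord [NormalSpace X] (h𝒰 : IsFinOpenCover 𝒰)
    (h𝒱 : IsFinOpenCover 𝒱) : coverDim (join 𝒰 𝒱) ≤ ord 𝒰 + ord 𝒱 := by
  have := h𝒰.finite.fintype
  have := h𝒱.finite.fintype
  let := IsWellOrder.linearOrder (WellOrderingRel (α := 𝒰))
  let := IsWellOrder.linearOrder (WellOrderingRel (α := 𝒱))
  obtain ⟨f, hf⟩ := h𝒰.exists_partitionOfUnity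
  obtain ⟨g, hg⟩ := h𝒱.exists_partitionOfUnity
  have hrefines : Refines (overlapCover f g) (join 𝒰 𝒱) := by
    rintro _ ⟨⟨U, V⟩, rfl⟩
    exact ⟨_, mem_image2_of_mem U.2 V.2, fun x hx => ⟨hf U x hx.pos_left, hg V x hx.pos_right⟩⟩
  refine ((isFinOpenCover_overlapCover f g).coverDim_le_ord hrefines).trans ?_
  exact ord_overlapCover_le f g (fun x => encard_pos_le_ord_add_one fun U => hf U x)
    fun x => encard_pos_le_ord_add_one fun V => hg V x

theorem coverDim_join_le [NormalSpace X] (𝒰 𝒱 : Set (Set X)) :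
    coverDim (join 𝒰 𝒱) ≤ coverDim 𝒰 + coverDim 𝒱 := by
  refine ENat.le_iInf₂_add_iInf₂ fun 𝒰' h𝒰' 𝒱' h𝒱' => ?_
  calc coverDim (join 𝒰 𝒱) ≤ coverDim (join 𝒰' 𝒱') := coverDim_le_of_refines
        (((join_refines_left _ _).trans h𝒰'.2).join ((join_refines_right _ _).trans h𝒱'.2))
    _ ≤ ord 𝒰' + ord 𝒱' := coverDim_join_le_ord_add_ord h𝒰'.1 h𝒱'.1

theorem coverDim_finJoin_le [NormalSpace X] {ι : Type*} (s : Finset ι) (𝒰 : ι → Set (Set X)) :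
    coverDim (finJoin s 𝒰) ≤ ∑ i ∈ s, coverDim (𝒰 i) := by
  classical
  induction s using Finset.induction_on with
  | empty =>
    have huniv : IsFinOpenCover {(univ : Set X)} :=
      ⟨finite_singleton _, by simp, sUnion_singleton _⟩
    refine (huniv.coverDim_le_ord (refines_finJoin_iff.2 (by simp))).trans ?_
    refine ord_le_iff.2 fun x => (encard_le_encard (sep_subset _ _)).trans ?_
    simp
  | insert i s hi ih =>
    rw [Finset.sum_insert hi]
    have hrefines : Refines (join (𝒰 i) (finJoin s 𝒰)) (finJoin (insert i s) 𝒰) := by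
      refine refines_finJoin_iff.2 fun j hj => ?_
      rcases Finset.mem_insert.1 hj with rfl | hj
      · exact join_refines_left _ _
      · exact (join_refines_right _ _).trans (finJoin_refines hj)
    calc coverDim (finJoin (insert i s) 𝒰) ≤ coverDim (join (𝒰 i) (finJoin s 𝒰)) :=
          coverDim_le_of_refines hrefines
      _ ≤ coverDim (𝒰 i) + coverDim (finJoin s 𝒰) := coverDim_join_le _ _
      _ ≤ coverDim (𝒰 i) + ∑ j ∈ s, coverDim (𝒰 j) := by gcongr

theorem coverDim_joinCover_le [NormalSpace X] {Γ : Type*} [Group Γ] [MulAction Γ X]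
    [ContinuousConstSMul Γ X] (𝒰 : Set (Set X)) (A : Finset Γ) :
    coverDim (joinCover 𝒰 A) ≤ A.card * coverDim 𝒰 := by
  rw [joinCover_eq_finJoin, ← nsmul_eq_mul]
  exact (coverDim_finJoin_le _ _).trans
    (Finset.sum_le_card_nsmul _ _ _ fun s _ => coverDim_preimage_le (continuous_const_smul s) 𝒰)

end CoverDim

section ProductRefinement

variable {X Z : Type*} [TopologicalSpace X] [TopologicalSpace Z]

/-- The cover whose members are the cells `⋂ {P i | i ∈ t, x ∈ P i}` of the points `x`. -/
def cellCover {ι : Type*} (t : Finset ι) (P : ι → Set X) : Set (Set X) :=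
  range fun x => ⋂ i ∈ t, ⋂ (_ : x ∈ P i), P i

theorem isFinOpenCover_cellCover {ι : Type*} {t : Finset ι} {P : ι → Set X}
    (hP : ∀ i ∈ t, IsOpen (P i)) : IsFinOpenCover (cellCover t P) where
  finite := by
    classical
    refine (t.powerset.finite_toSet.image fun I => ⋂ i ∈ I, P i).subset ?_
    rintro _ ⟨x, rfl⟩
    exact ⟨t.filter (x ∈ P ·), Finset.mem_powerset.2 (Finset.filter_subset _ t),
      by simp [iInter_and]⟩
  isOpen := by
    rintro _ ⟨x, rfl⟩
    exact isOpen_biInter_finset fun i hi => isOpen_iInter_of_finite fun _ => hP i hi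
  covers := eq_univ_of_forall fun x => ⟨_, mem_range_self x, by simp⟩

theorem exists_prod_refinement [CompactSpace X] [CompactSpace Z] {𝒰 : Set (Set (X × Z))}
    (hopen : ∀ U ∈ 𝒰, IsOpen U) (hcovers : ⋃₀ 𝒰 = univ) :
    ∃ (𝒜 : Set (Set X)) (ℬ : Set (Set Z)), IsFinOpenCover 𝒜 ∧ IsFinOpenCover ℬ ∧
      ∀ A ∈ 𝒜, ∀ B ∈ ℬ, ∃ U ∈ 𝒰, A ×ˢ B ⊆ U := by
  have hrect : ∀ w, ∃ (P : Set X) (Q : Set Z), IsOpen P ∧ IsOpen Q ∧ w ∈ P ×ˢ Q ∧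
      ∃ U ∈ 𝒰, P ×ˢ Q ⊆ U := fun w => by
    obtain ⟨U, hU, hw⟩ := mem_sUnion.1 (hcovers ▸ mem_univ w)
    obtain ⟨P, Q, hP, hQ, hwP, hwQ, hPQ⟩ := isOpen_prod_iff.1 (hopen U hU) w.1 w.2 hw
    exact ⟨P, Q, hP, hQ, ⟨hwP, hwQ⟩, U, hU, hPQ⟩
  choose P Q hP hQ hw U hU hPQ using hrect
  obtain ⟨t, ht⟩ := (isCompact_univ (X := X × Z)).elim_finite_subcover
    (fun w => P w ×ˢ Q w) (fun w => (hP w).prod (hQ w)) fun w _ => mem_iUnion.2 ⟨w, hw w⟩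
  refine ⟨cellCover t P, cellCover t Q, isFinOpenCover_cellCover fun w _ => hP w,
    isFinOpenCover_cellCover fun w _ => hQ w, ?_⟩
  rintro _ ⟨x, rfl⟩ _ ⟨z, rfl⟩
  obtain ⟨w, hwt, hxw, hzw⟩ := mem_iUnion₂.1 (ht (mem_univ (x, z)))
  exact ⟨U w, hU w, (Set.prod_mono (biInter_subset_of_mem hwt |>.trans (iInter_subset _ hxw))
    (biInter_subset_of_mem hwt |>.trans (iInter_subset _ hzw))).trans (hPQ w)⟩

end ProductRefinement

/-! ### Quasi-tilings by Følner sets -/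

section QuasiTiling

open scoped Pointwise RightActions

variable {Γ : Type*} [Group Γ]

theorem almostInvariant_mem_invariantFilter {K : Finset Γ} (hK : K.Nonempty) {δ : ℝ}
    (hδ : 0 < δ) : almostInvariant K δ ∈ invariantFilter Γ :=
  mem_iInf_of_mem K <| mem_iInf_of_mem hK <| mem_iInf_of_mem δ <| mem_iInf_of_mem hδ <|
    mem_principal_self _

variable [DecidableEq Γ]

/-- The set of points outside `B` that some element of `E` moves into `B`. -/
def outerBoundary (E B : Finset Γ) : Finset Γ := (E⁻¹ * B) \ B

theorem mem_outerBoundary {E B : Finset Γ} {x : Γ} :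
    x ∈ outerBoundary E B ↔ (∃ e ∈ E, e * x ∈ B) ∧ x ∉ B := by
  rw [outerBoundary, Finset.mem_sdiff, Finset.mem_mul, and_congr_left_iff]
  refine fun _ => ⟨?_, fun ⟨e, he, hex⟩ => ⟨e⁻¹, Finset.inv_mem_inv he, e * x, hex, by group⟩⟩
  rintro ⟨e, he, b, hb, rfl⟩
  exact ⟨e⁻¹, Finset.mem_inv'.1 he, by simpa using hb⟩

theorem outerBoundary_mono {E E' : Finset Γ} (h : E ⊆ E') (B : Finset Γ) :
    outerBoundary E B ⊆ outerBoundary E' B :=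
  Finset.sdiff_subset_sdiff (Finset.mul_subset_mul_right (Finset.inv_subset_inv h)) subset_rfl

theorem outerBoundary_smul (E B : Finset Γ) (c : Γ) :
    outerBoundary E (B <• c) = outerBoundary E B <• c := by
  rw [outerBoundary, outerBoundary, Finset.smul_finset_sdiff, mul_smul_comm]

theorem outerBoundary_biUnion_subset {ι : Type*} (E : Finset Γ) (s : Finset ι)
    (B : ι → Finset Γ) :
    outerBoundary E (s.biUnion B) ⊆ s.biUnion fun i => outerBoundary E (B i) := by
  intro x hx
  simp only [mem_outerBoundary, Finset.mem_biUnion] at hx ⊢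
  obtain ⟨⟨e, he, i, hi, hex⟩, hxB⟩ := hx
  exact ⟨i, hi, ⟨e, he, hex⟩, fun hxi => hxB ⟨i, hi, hxi⟩⟩

theorem card_outerBoundary_le_sum (E B : Finset Γ) :
    (outerBoundary E B).card ≤
      ∑ e ∈ E, (symmDiff ((fun t => e⁻¹ * t) '' (B : Set Γ)) (B : Set Γ)).ncard := by
  have hsub : outerBoundary E B ⊆ E.biUnion fun e => symmDiff (e⁻¹ • B) B := fun x hx => by
    obtain ⟨⟨e, he, hex⟩, hxB⟩ := mem_outerBoundary.1 hx
    exact Finset.mem_biUnion.2 ⟨e, he, Finset.mem_symmDiff.2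
      (Or.inl ⟨Finset.mem_inv_smul_finset_iff.2 hex, hxB⟩)⟩
  refine (Finset.card_le_card hsub).trans (Finset.card_biUnion_le.trans_eq ?_)
  refine Finset.sum_congr rfl fun e _ => ?_
  rw [← ncard_coe_finset, Finset.coe_symmDiff, Finset.coe_smul_finset]
  rfl

theorem IsFolnerSeq.eventually_card_outerBoundary_le {F : ℕ → Finset Γ} (hF : IsFolnerSeq F)
    (E : Finset Γ) {η : ℝ} (hη : 0 < η) :
    ∀ᶠ n in atTop, ((outerBoundary E (F n)).card : ℝ) ≤ η * (F n).card := by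
  have hsum := tendsto_finsetSum E fun e _ => hF.tendsto e⁻¹
  rw [Finset.sum_const_zero] at hsum
  filter_upwards [hsum.eventually_le_const hη] with n hn
  rw [← Finset.sum_div, div_le_iff₀ (by exact_mod_cast (hF.nonempty n).card_pos)] at hn
  exact le_trans (mod_cast card_outerBoundary_le_sum E (F n)) hn

theorem mul_card_le_card_of_forall_inter {K C B : Finset Γ} (hK : K.Nonempty) {ε : ℝ}
    (h : ∀ c ∈ C, ε * K.card ≤ ((K <• c) ∩ B).card) : ε * C.card ≤ B.card := by
  have hmult : ∀ b ∈ B, (C.filter (b ∈ K <• ·)).card ≤ K.card := fun b _ =>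
    calc (C.filter (b ∈ K <• ·)).card ≤ (K⁻¹ <• b).card := Finset.card_le_card fun c hc => by
          obtain ⟨k, hk, rfl⟩ := Finset.mem_smul_finset.1 (Finset.mem_filter.1 hc).2
          exact Finset.mem_smul_finset.2 ⟨k⁻¹, Finset.inv_mem_inv hk, by simp⟩
      _ = K.card := by rw [Finset.card_smul_finset, Finset.card_inv]
  have hcount : ∑ c ∈ C, ((K <• c) ∩ B).card = ∑ b ∈ B, (C.filter (b ∈ K <• ·)).card := by
    simp only [Finset.inter_comm _ B, ← Finset.filter_mem_eq_inter]
    exact Finset.sum_card_bipartiteAbove_eq_sum_card_bipartiteBelow fun c b => b ∈ K <• c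
  have hKpos : (0 : ℝ) < K.card := mod_cast hK.card_pos
  refine le_of_mul_le_mul_right ?_ hKpos
  calc ε * C.card * K.card = ∑ _c ∈ C, ε * K.card := by
        rw [Finset.sum_const, nsmul_eq_mul]; ring
    _ ≤ ∑ c ∈ C, (((K <• c) ∩ B).card : ℝ) := Finset.sum_le_sum h
    _ = ∑ b ∈ B, ((C.filter (b ∈ K <• ·)).card : ℝ) := mod_cast hcount
    _ ≤ ∑ _b ∈ B, (K.card : ℝ) := Finset.sum_le_sum fun b hb => mod_cast hmult b hb
    _ = B.card * K.card := by rw [Finset.sum_const, nsmul_eq_mul]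

theorem card_filter_not_le_of_mem_almostInvariant {K A : Finset Γ} {δ : ℝ}
    (hA : A ∈ almostInvariant K δ) : ((A.filter (¬ K <• · ⊆ A)).card : ℝ) ≤ δ * A.card := by
  have hcore : {t : Γ | t ∈ A ∧ ∀ k ∈ K, k * t ∈ A} = A.filter (K <• · ⊆ A) := by
    ext t
    simp [Finset.subset_iff, Finset.mem_smul_finset]
  have hle := hA.2
  rw [hcore, ncard_coe_finset] at hle
  have hadd := Finset.card_filter_add_card_filter_not (s := A) (K <• · ⊆ A)
  have hadd' : ((A.filter (K <• · ⊆ A)).card : ℝ) + (A.filter (¬ K <• · ⊆ A)).card = A.card :=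
    mod_cast hadd
  linarith

-- A translate `K * c ⊆ A` with `c` outside `B₀` and its `K`-boundary is disjoint from `B₀`, so
-- its points in `B` are newly covered; double counting then bounds `B \ B₀` from below.
theorem card_sdiff_le_of_saturated {K A B₀ B : Finset Γ} {ε δ θ : ℝ} (hK : K.Nonempty)
    (hε : 0 ≤ ε) (hB₀ : B₀ ⊆ B) (hB : B ⊆ A) (hA : A ∈ almostInvariant K δ)
    (hbdry : ((outerBoundary K B₀).card : ℝ) ≤ θ * A.card)
    (hsat : ∀ c ∈ A, K <• c ⊆ A → ε * K.card ≤ ((K <• c) ∩ B).card) :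
    ((A \ B).card : ℝ) ≤ (1 - ε) * (A \ B₀).card + ε * ((δ + θ) * A.card) := by
  set C := ((A \ B₀).filter (K <• · ⊆ A)) \ outerBoundary K B₀ with hC
  have hcover : ε * C.card ≤ (B \ B₀).card := by
    refine mul_card_le_card_of_forall_inter hK fun c hc => ?_
    simp only [hC, Finset.mem_sdiff, Finset.mem_filter, mem_outerBoundary, not_and, not_not] at hc
    obtain ⟨⟨⟨hcA, hcB₀⟩, hsub⟩, hcbdry⟩ := hc
    refine (hsat c hcA hsub).trans (mod_cast Finset.card_le_card fun x hx => ?_)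
    obtain ⟨hxK, hxB⟩ := Finset.mem_inter.1 hx
    obtain ⟨k, hk, rfl⟩ := Finset.mem_smul_finset.1 hxK
    exact Finset.mem_inter.2 ⟨hxK, Finset.mem_sdiff.2
      ⟨hxB, fun hxB₀ => hcB₀ (hcbdry ⟨k, hk, hxB₀⟩)⟩⟩
  have huncovered : ((A \ B₀).card : ℝ) ≤ C.card + (δ + θ) * A.card := by
    have hsub : A \ B₀ ⊆ C ∪ (A.filter (¬ K <• · ⊆ A) ∪ outerBoundary K B₀) := fun x hx => by
      simp only [hC, Finset.mem_union, Finset.mem_sdiff, Finset.mem_filter] at hx ⊢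
      tauto
    have hcard : ((A \ B₀).card : ℝ) ≤
        C.card + ((A.filter (¬ K <• · ⊆ A)).card + (outerBoundary K B₀).card) := by
      exact_mod_cast (Finset.card_le_card hsub).trans ((Finset.card_union_le _ _).trans
        (Nat.add_le_add_left (Finset.card_union_le _ _) _))
    linarith [card_filter_not_le_of_mem_almostInvariant hA]
  have hsplit : ((A \ B₀).card : ℝ) = (A \ B).card + (B \ B₀).card := by
    rw [← Finset.sdiff_union_sdiff_cancel hB hB₀]
    exact_mod_cast Finset.card_union_of_disjoint
      (Finset.disjoint_sdiff.symm.mono_right Finset.sdiff_subset)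
  nlinarith

section Packing

variable {ι : Type*} {F : ι → Finset Γ} {ε η : ℝ} {I J : Finset ι} {A : Finset Γ}
  {P : Finset (ι × Γ)}

/-- The union of the tiles `F i * c`, for the pairs `(i, c)` of a shape and a centre in `P`. -/
def tileUnion (F : ι → Finset Γ) (P : Finset (ι × Γ)) : Finset Γ :=
  P.biUnion fun p => F p.1 <• p.2

/-- The tiles `F i * c`, `(i, c) ∈ P`, have shapes in `I` and centres in `A`, are contained in `A`,
and are `ε`-disjoint in the sense that overlaps waste at most the proportion `ε` of their
cardinalities. -/
structure IsTilePacking (F : ι → Finset Γ) (ε : ℝ) (I : Finset ι) (A : Finset Γ)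
    (P : Finset (ι × Γ)) : Prop where
  shape_mem : ∀ p ∈ P, p.1 ∈ I
  center_mem : ∀ p ∈ P, p.2 ∈ A
  tile_subset : ∀ p ∈ P, F p.1 <• p.2 ⊆ A
  mul_sum_card_le : (1 - ε) * ∑ p ∈ P, ((F p.1).card : ℝ) ≤ (tileUnion F P).card

theorem isTilePacking_empty : IsTilePacking F ε I A ∅ where
  shape_mem := by simp
  center_mem := by simp
  tile_subset := by simp
  mul_sum_card_le := by simp

namespace IsTilePacking

theorem mono (hP : IsTilePacking F ε I A P) (hIJ : I ⊆ J) : IsTilePacking F ε J A P :=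
  { hP with shape_mem := fun p hp => hIJ (hP.shape_mem p hp) }

theorem tileUnion_subset (hP : IsTilePacking F ε I A P) : tileUnion F P ⊆ A :=
  Finset.biUnion_subset.2 hP.tile_subset

theorem insert [DecidableEq ι] (hP : IsTilePacking F ε I A P) {i : ι} {c : Γ} (hi : i ∈ I)
    (hc : c ∈ A) (hsub : F i <• c ⊆ A) (hmem : (i, c) ∉ P)
    (hinter : ((F i <• c) ∩ tileUnion F P).card ≤ ε * (F i).card) :
    IsTilePacking F ε I A (insert (i, c) P) where
  shape_mem := Finset.forall_mem_insert _ _ _ |>.2 ⟨hi, hP.shape_mem⟩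
  center_mem := Finset.forall_mem_insert _ _ _ |>.2 ⟨hc, hP.center_mem⟩
  tile_subset := Finset.forall_mem_insert _ _ _ |>.2 ⟨hsub, hP.tile_subset⟩
  mul_sum_card_le := by
    have hcard := Finset.card_union_add_card_inter (F i <• c) (tileUnion F P)
    rw [Finset.card_smul_finset] at hcard
    have hcard' : (((F i <• c) ∪ tileUnion F P).card : ℝ) + ((F i <• c) ∩ tileUnion F P).card =
      (F i).card + (tileUnion F P).card := mod_cast hcard
    rw [Finset.sum_insert hmem, tileUnion, Finset.biUnion_insert]
    change _ ≤ (((F i <• c) ∪ tileUnion F P).card : ℝ)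
    linarith [hP.mul_sum_card_le]

theorem exists_saturated (hP : IsTilePacking F ε I A P) (hε : ε ≤ 1) :
    ∃ Q, P ⊆ Q ∧ IsTilePacking F ε I A Q ∧ ∀ i ∈ I, ∀ c ∈ A, F i <• c ⊆ A →
      ε * (F i).card ≤ ((F i <• c) ∩ tileUnion F Q).card := by
  classical
  have hfin : {Q | IsTilePacking F ε I A Q}.Finite :=
    (I ×ˢ A).powerset.finite_toSet.subset fun Q hQ => Finset.mem_powerset.2 fun p hp =>
      Finset.mem_product.2 ⟨hQ.shape_mem p hp, hQ.center_mem p hp⟩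
  obtain ⟨Q, hPQ, hQ, hmax⟩ := hfin.exists_le_maximal hP
  refine ⟨Q, hPQ, hQ, fun i hi c hc hsub => ?_⟩
  by_cases hmem : (i, c) ∈ Q
  · have hcovered : F i <• c ⊆ tileUnion F Q :=
      Finset.subset_biUnion_of_mem (fun p => F p.1 <• p.2) hmem
    rw [Finset.inter_eq_left.2 hcovered, Finset.card_smul_finset]
    exact mul_le_of_le_one_left (Nat.cast_nonneg _) hε
  · by_contra! hinter
    exact hmem (hmax (hQ.insert hi hc hsub hmem hinter.le) (Finset.subset_insert _ _)
      (Finset.mem_insert_self _ _))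

theorem card_outerBoundary_tileUnion_le (hP : IsTilePacking F ε I A P) (hε : ε ≤ 1 / 2)
    (hη : 0 ≤ η) {E : Finset Γ}
    (hE : ∀ i ∈ I, ((outerBoundary E (F i)).card : ℝ) ≤ η * (F i).card) :
    ((outerBoundary E (tileUnion F P)).card : ℝ) ≤ 2 * η * A.card := by
  have hsum : ∑ p ∈ P, ((F p.1).card : ℝ) ≤ 2 * A.card := by
    have hle : ((tileUnion F P).card : ℝ) ≤ A.card :=
      mod_cast Finset.card_le_card hP.tileUnion_subset
    have hnonneg : 0 ≤ ∑ p ∈ P, ((F p.1).card : ℝ) := by positivity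
    nlinarith [hP.mul_sum_card_le]
  calc ((outerBoundary E (tileUnion F P)).card : ℝ)
      ≤ ∑ p ∈ P, ((outerBoundary E (F p.1 <• p.2)).card : ℝ) := mod_cast
        (Finset.card_le_card (outerBoundary_biUnion_subset E P _)).trans Finset.card_biUnion_le
    _ ≤ ∑ p ∈ P, η * (F p.1).card := Finset.sum_le_sum fun p hp => by
        rw [outerBoundary_smul, Finset.card_smul_finset]
        exact hE _ (hP.shape_mem p hp)
    _ = η * ∑ p ∈ P, ((F p.1).card : ℝ) := (Finset.mul_sum ..).symm
    _ ≤ 2 * η * A.card := by nlinarith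

end IsTilePacking
end Packing

-- Each induction step adds one shape `F n`, laid after the shapes of `I`. These are chosen after
-- `n`, almost invariant under `F n`, so that their tiles leave a small `F n`-boundary.
theorem IsFolnerSeq.exists_isTilePacking {F : ℕ → Finset Γ} (hF : IsFolnerSeq F) {ε η : ℝ}
    (hε : 0 ≤ ε) (hε' : ε ≤ 1 / 2) (hη : 0 < η) (N m : ℕ) (E : Finset Γ) :
    ∃ I : Finset ℕ, (∀ n ∈ I, N ≤ n ∧ ((outerBoundary E (F n)).card : ℝ) ≤ η * (F n).card) ∧
      ∀ᶠ A in invariantFilter Γ, ∃ P, IsTilePacking F ε I A P ∧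
        ((A \ tileUnion F P).card : ℝ) ≤ ((1 - ε) ^ m + 3 * η) * A.card := by
  induction m generalizing E with
  | zero =>
    refine ⟨∅, by simp, Eventually.of_forall fun A => ⟨∅, isTilePacking_empty, ?_⟩⟩
    simp only [tileUnion, Finset.biUnion_empty, Finset.sdiff_empty, pow_zero]
    exact le_mul_of_one_le_left (Nat.cast_nonneg _) (by linarith)
  | succ m ih =>
    obtain ⟨n, hNn, hn⟩ :=
      ((eventually_ge_atTop N).and (hF.eventually_card_outerBoundary_le E hη)).exists
    obtain ⟨I, hI, hpack⟩ := ih (E ∪ F n)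
    have hbdry_mono : ∀ K ⊆ E ∪ F n, ∀ i ∈ I,
        ((outerBoundary K (F i)).card : ℝ) ≤ η * (F i).card := fun K hK i hi =>
      le_trans (mod_cast Finset.card_le_card (outerBoundary_mono hK _)) (hI i hi).2
    refine ⟨insert n I, Finset.forall_mem_insert _ _ _ |>.2 ⟨⟨hNn, hn⟩, fun i hi =>
      ⟨(hI i hi).1, hbdry_mono E Finset.subset_union_left i hi⟩⟩, ?_⟩
    filter_upwards [hpack, almostInvariant_mem_invariantFilter (hF.nonempty n) hη]
      with A ⟨P, hP, hPA⟩ hA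
    obtain ⟨Q, hPQ, hQ, hsat⟩ :=
      (hP.mono (Finset.subset_insert n I)).exists_saturated (by linarith)
    have hfill := card_sdiff_le_of_saturated (hF.nonempty n) hε
      (Finset.biUnion_subset_biUnion_of_subset_left _ hPQ) hQ.tileUnion_subset hA
      (hP.card_outerBoundary_tileUnion_le hε' hη.le (hbdry_mono _ Finset.subset_union_right))
      (hsat n (Finset.mem_insert_self _ _))
    refine ⟨Q, hQ, hfill.trans ?_⟩
    calc (1 - ε) * ((A \ tileUnion F P).card : ℝ) + ε * ((η + 2 * η) * A.card)
        ≤ (1 - ε) * (((1 - ε) ^ m + 3 * η) * A.card) + ε * ((η + 2 * η) * A.card) := by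
          gcongr
          linarith
      _ = ((1 - ε) ^ (m + 1) + 3 * η) * A.card := by ring

theorem IsFolnerSeq.exists_quasitiling {F : ℕ → Finset Γ} (hF : IsFolnerSeq F) {ε : ℝ}
    (hε : 0 < ε) (N : ℕ) :
    ∃ I : Finset ℕ, (∀ n ∈ I, N ≤ n) ∧ ∀ᶠ A in invariantFilter Γ, ∃ P : Finset (ℕ × Γ),
      (∀ p ∈ P, p.1 ∈ I ∧ p.2 ∈ A) ∧
        ∑ p ∈ P, ((F p.1).card : ℝ) ≤ (1 + ε) * A.card ∧
          ((A \ tileUnion F P).card : ℝ) ≤ ε * A.card := by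
  obtain ⟨ε', hε'0, hε'⟩ := exists_between (show 0 < min (ε / 2) (1 / 4) by positivity)
  obtain ⟨hε'ε, hε'1⟩ := lt_min_iff.1 hε'
  obtain ⟨m, hm⟩ := exists_pow_lt_of_lt_one (half_pos hε) (show 1 - ε' < 1 by linarith)
  obtain ⟨I, hI, hpack⟩ := hF.exists_isTilePacking hε'0.le (by linarith)
    (show 0 < ε / 6 by positivity) N m ∅
  refine ⟨I, fun n hn => (hI n hn).1, ?_⟩
  filter_upwards [hpack] with A ⟨P, hP, hPA⟩
  refine ⟨P, fun p hp => ⟨hP.shape_mem p hp, hP.center_mem p hp⟩, ?_, hPA.trans ?_⟩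
  · have htiles : (1 - ε') * ∑ p ∈ P, ((F p.1).card : ℝ) ≤ A.card :=
      hP.mul_sum_card_le.trans (mod_cast Finset.card_le_card hP.tileUnion_subset)
    calc ∑ p ∈ P, ((F p.1).card : ℝ)
        ≤ (1 + ε) * (1 - ε') * ∑ p ∈ P, ((F p.1).card : ℝ) :=
          le_mul_of_one_le_left (by positivity) (by nlinarith)
      _ ≤ (1 + ε) * A.card := by rw [mul_assoc]; gcongr
  · gcongr
    linarith

end QuasiTiling

/-! ### Factor maps whose fibres have controlled dimension -/

section FactorMap

open scoped Pointwise RightActions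

variable {Γ X Y : Type*} [Group Γ] [MulAction Γ X] [MulAction Γ Y]

section Tiles

variable [DecidableEq Γ] {ι : Type*} {F : ι → Finset Γ} {f : X → Y} {𝒰 : Set (Set X)}
  {𝒱 : Set (Set Y)} {𝒞 : ι → Set (Set X)} {A : Finset Γ} {P : Finset (ι × Γ)}

theorem refines_joinCover_of_tiles (hfΓ : ∀ (s : Γ) x, f (s • x) = s • f x)
    (hPA : ∀ p ∈ P, p.2 ∈ A)
    (h𝒞 : ∀ p ∈ P, Refines (join (Set.preimage f '' 𝒱) (𝒞 p.1)) (joinCover 𝒰 (F p.1))) :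
    Refines (join (Set.preimage f '' joinCover 𝒱 A)
      (join (finJoin P fun p => Set.preimage (p.2 • ·) '' 𝒞 p.1)
        (joinCover 𝒰 (A \ tileUnion F P)))) (joinCover 𝒰 A) := by
  set 𝒬 := join (Set.preimage f '' joinCover 𝒱 A)
      (join (finJoin P fun p => Set.preimage (p.2 • ·) '' 𝒞 p.1)
        (joinCover 𝒰 (A \ tileUnion F P)))
  refine refines_joinCover_iff.2 fun s hs => ?_
  by_cases hsP : s ∈ tileUnion F P
  · obtain ⟨⟨i, c⟩, hp, hsp⟩ := Finset.mem_biUnion.1 hsP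
    obtain ⟨t, ht, rfl⟩ := Finset.mem_smul_finset.1 hsp
    have hbase : Refines 𝒬 (Set.preimage (c • ·) '' (Set.preimage f '' 𝒱)) := by
      have hcomm : f ∘ (c • ·) = (c • ·) ∘ f := funext (hfΓ c)
      simpa only [image_image, ← preimage_comp, hcomm] using
        (join_refines_left _ _).trans ((joinCover_refines (hPA _ hp)).preimage f)
    have hfiber : Refines 𝒬 (Set.preimage (c • ·) '' 𝒞 i) :=
      (join_refines_right _ _).trans ((join_refines_left _ _).trans (finJoin_refines hp))
    have htile : Refines 𝒬 (Set.preimage (c • ·) '' joinCover 𝒰 (F i)) := by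
      refine Refines.trans ?_ ((h𝒞 _ hp).preimage (c • ·))
      rw [preimage_image_join]
      exact hbase.join hfiber
    simpa only [image_image, ← preimage_comp, comp_smul_left, MulOpposite.smul_eq_mul_unop,
      MulOpposite.unop_op] using htile.trans ((joinCover_refines ht).preimage _)
  · exact (join_refines_right _ _).trans ((join_refines_right _ _).trans
      (joinCover_refines (Finset.mem_sdiff.2 ⟨hs, hsP⟩)))

variable [TopologicalSpace X] [TopologicalSpace Y] [ContinuousConstSMul Γ X] [NormalSpace X]

theorem coverDim_joinCover_le_of_tiles (hf : Continuous f)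
    (hfΓ : ∀ (s : Γ) x, f (s • x) = s • f x) (hPA : ∀ p ∈ P, p.2 ∈ A)
    (h𝒞 : ∀ p ∈ P, Refines (join (Set.preimage f '' 𝒱) (𝒞 p.1)) (joinCover 𝒰 (F p.1))) :
    coverDim (joinCover 𝒰 A) ≤ coverDim (joinCover 𝒱 A) +
      (∑ p ∈ P, coverDim (𝒞 p.1) + (A \ tileUnion F P).card * coverDim 𝒰) := by
  refine (coverDim_le_of_refines (refines_joinCover_of_tiles hfΓ hPA h𝒞)).trans ?_
  refine (coverDim_join_le _ _).trans (add_le_add (coverDim_preimage_le hf _) ?_)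
  refine (coverDim_join_le _ _).trans (add_le_add ?_ (coverDim_joinCover_le _ _))
  exact (coverDim_finJoin_le _ _).trans (Finset.sum_le_sum fun p _ =>
    coverDim_preimage_le (continuous_const_smul p.2) _)

theorem coverDim_joinCover_le_of_quasitiling {S ε : ℝ≥0} (hf : Continuous f)
    (hfΓ : ∀ (s : Γ) x, f (s • x) = s • f x) (hPA : ∀ p ∈ P, p.2 ∈ A)
    (h𝒞 : ∀ p ∈ P, Refines (join (Set.preimage f '' 𝒱) (𝒞 p.1)) (joinCover 𝒰 (F p.1)))
    (hS : ∀ p ∈ P, (coverDim (𝒞 p.1) : ℝ≥0∞) ≤ S * (F p.1).card)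
    (hsum : ∑ p ∈ P, ((F p.1).card : ℝ) ≤ (1 + ε) * A.card)
    (hrest : ((A \ tileUnion F P).card : ℝ) ≤ ε * A.card) :
    (coverDim (joinCover 𝒰 A) : ℝ≥0∞) ≤
      coverDim (joinCover 𝒱 A) + (S * (1 + ε) + ε * coverDim 𝒰) * A.card := by
  have hsum' : ∑ p ∈ P, ((F p.1).card : ℝ≥0∞) ≤ (1 + ε) * A.card := by
    exact_mod_cast show ∑ p ∈ P, ((F p.1).card : ℝ≥0) ≤ (1 + ε) * A.card from mod_cast hsum
  have hrest' : ((A \ tileUnion F P).card : ℝ≥0∞) ≤ ε * A.card := by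
    exact_mod_cast show ((A \ tileUnion F P).card : ℝ≥0) ≤ ε * A.card from mod_cast hrest
  calc (coverDim (joinCover 𝒰 A) : ℝ≥0∞)
      ≤ ((coverDim (joinCover 𝒱 A) + (∑ p ∈ P, coverDim (𝒞 p.1) +
          (A \ tileUnion F P).card * coverDim 𝒰) : ℕ∞) : ℝ≥0∞) :=
        ENat.toENNReal_le.2 (coverDim_joinCover_le_of_tiles hf hfΓ hPA h𝒞)
    _ = coverDim (joinCover 𝒱 A) + (∑ p ∈ P, (coverDim (𝒞 p.1) : ℝ≥0∞) +
          (A \ tileUnion F P).card * coverDim 𝒰) := by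
        rw [ENat.toENNReal_add, ENat.toENNReal_add, ENat.toENNReal_mul, ENat.toENNReal_coe]
        congr 2
        exact map_sum ENat.toENNRealRingHom _ _
    _ ≤ coverDim (joinCover 𝒱 A) + (S * ((1 + ε) * A.card) + ε * A.card * coverDim 𝒰) := by
        gcongr
        refine (Finset.sum_le_sum hS).trans ?_
        rw [← Finset.mul_sum]
        gcongr
    _ = coverDim (joinCover 𝒱 A) + (S * (1 + ε) + ε * coverDim 𝒰) * A.card := by ring

end Tiles

section MeanDimension

variable [TopologicalSpace X] [TopologicalSpace Y] {F : ℕ → Finset Γ}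

theorem limsup_le_mdim {𝒰 : Set (Set X)} (h𝒰 : IsFinOpenCover 𝒰) :
    limsup (fun A : Finset Γ => (coverDim (joinCover 𝒰 A) : ℝ≥0∞) / (A.card : ℝ≥0∞))
      (invariantFilter Γ) ≤ mdim Γ X :=
  le_iSup₂_of_le 𝒰 h𝒰 le_rfl

theorem limsup_le_mdimOn (F : ℕ → Finset Γ) (K : Set X) {𝒰 : Set (Set X)}
    (h𝒰 : IsFinOpenCover 𝒰) :
    limsup (fun n => (coverDim (restrictCover (joinCover 𝒰 (F n)) K) : ℝ≥0∞)
      / ((F n).card : ℝ≥0∞)) atTop ≤ mdimOn F K :=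
  le_iSup₂_of_le 𝒰 h𝒰 le_rfl

variable (Γ X) in
theorem mdim_eq_zero_of_isEmpty [IsEmpty X] : mdim Γ X = 0 := by
  have hcover : IsFinOpenCover (∅ : Set (Set X)) := ⟨finite_empty, by simp, Subsingleton.elim _ _⟩
  have hdim : ∀ 𝒰 : Set (Set X), coverDim 𝒰 = 0 := fun 𝒰 =>
    nonpos_iff_eq_zero.1 <| (hcover.coverDim_le_ord (by simp [Refines])).trans <|
      ord_le_iff.2 isEmptyElim
  refine nonpos_iff_eq_zero.1 (iSup₂_le fun 𝒰 _ => limsup_le_of_le (h := ?_))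
  simp [hdim]

theorem limsup_le_limsup_add {ι : Type*} {l : Filter ι} {f g : ι → ℝ≥0∞} {c : ℝ≥0∞}
    (h : ∀ᶠ i in l, f i ≤ g i + c) : limsup f l ≤ limsup g l + c := by
  rw [limsup_eq (u := g), ENNReal.sInf_add]
  refine le_iInf₂ fun b hb => limsup_le_of_le (h := ?_)
  filter_upwards [h, hb] with i hi hbi
  exact hi.trans (by gcongr)

theorem limsup_coverDim_joinCover_le [ContinuousConstSMul Γ X] [NormalSpace X]
    (hF : IsFolnerSeq F) {f : X → Y} (hf : Continuous f)
    (hfΓ : ∀ (s : Γ) x, f (s • x) = s • f x) {𝒰 : Set (Set X)} (h𝒰 : IsFinOpenCover 𝒰)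
    {S : ℝ≥0} {N : ℕ}
    (hfiber : ∀ I : Finset ℕ, (∀ n ∈ I, N ≤ n) → ∃ (𝒱 : Set (Set Y)) (𝒞 : ℕ → Set (Set X)),
      IsFinOpenCover 𝒱 ∧ ∀ n ∈ I, (coverDim (𝒞 n) : ℝ≥0∞) ≤ S * (F n).card ∧
        Refines (join (Set.preimage f '' 𝒱) (𝒞 n)) (joinCover 𝒰 (F n))) :
    limsup (fun A : Finset Γ => (coverDim (joinCover 𝒰 A) : ℝ≥0∞) / (A.card : ℝ≥0∞))
      (invariantFilter Γ) ≤ mdim Γ Y + S := by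
  classical
  have hbound : ∀ ε : ℝ≥0, 0 < ε →
      limsup (fun A : Finset Γ => (coverDim (joinCover 𝒰 A) : ℝ≥0∞) / (A.card : ℝ≥0∞))
        (invariantFilter Γ) ≤ mdim Γ Y + (S * (1 + ε) + ε * coverDim 𝒰) := fun ε hε => by
    obtain ⟨I, hI, htile⟩ := hF.exists_quasitiling (NNReal.coe_pos.2 hε) N
    obtain ⟨𝒱, 𝒞, h𝒱, h𝒞⟩ := hfiber I hI
    refine (limsup_le_limsup_add ?_).trans (add_le_add_left (limsup_le_mdim h𝒱) _)
    filter_upwards [htile,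
      almostInvariant_mem_invariantFilter (Finset.singleton_nonempty 1) one_pos]
      with A ⟨P, hP, hsum, hrest⟩ hA
    have hA0 : (A.card : ℝ≥0∞) ≠ 0 := by simpa using hA.1.ne_empty
    rw [ENNReal.div_le_iff hA0 (ENNReal.natCast_ne_top _), add_mul,
      ENNReal.div_mul_cancel hA0 (ENNReal.natCast_ne_top _)]
    exact coverDim_joinCover_le_of_quasitiling hf hfΓ (fun p hp => (hP p hp).2)
      (fun p hp => (h𝒞 _ (hP p hp).1).2) (fun p hp => (h𝒞 _ (hP p hp).1).1) hsum hrest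
  obtain ⟨d, hd⟩ := ENat.ne_top_iff_exists.1 h𝒰.coverDim_ne_top
  have hlim : Tendsto (fun ε : ℝ≥0 => mdim Γ Y + (S * (1 + ε) + ε * coverDim 𝒰)) (𝓝[>] 0)
      (𝓝 (mdim Γ Y + S)) := by
    have hcont : Continuous fun ε : ℝ≥0 => ((S * (1 + ε) + ε * d : ℝ≥0) : ℝ≥0∞) :=
      ENNReal.continuous_coe.comp (by fun_prop)
    have hzero := (hcont.tendsto 0).mono_left (nhdsWithin_le_nhds (s := Ioi 0))
    simpa [← hd] using hzero.const_add (mdim Γ Y)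
  exact ge_of_tendsto hlim (eventually_mem_nhdsWithin.mono hbound)

end MeanDimension

end FactorMap

/-! ### The fibres of a skew product -/

namespace SkewProduct

variable {Γ Y G : Type*} [Group Γ] [TopologicalSpace Y] [MulAction Γ Y]
  [Group G] [TopologicalSpace G] [MulDistribMulAction Γ G] (σ : Cocycle Γ Y G)

instance [CompactSpace Y] [CompactSpace G] [R1Space Y] [IsTopologicalGroup G] :
    NormalSpace (SkewProduct σ) :=
  inferInstanceAs (NormalSpace (Y × G))

/-- The projection `Y ×_σ G → G`; unlike `proj`, it is not equivariant. -/
def fiberCoord (x : SkewProduct σ) : G := Prod.snd (α := Y) (β := G) x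

/-- The retraction `(z, g) ↦ (y, g)` of `Y ×_σ G` onto the fibre `π⁻¹(y)`. -/
def fiberRetraction (y : Y) (x : SkewProduct σ) : proj σ ⁻¹' {y} :=
  ⟨((y, fiberCoord σ x) : Y × G), rfl⟩

theorem continuous_proj : Continuous (proj σ) := continuous_fst (X := Y) (Y := G)

theorem continuous_fiberCoord : Continuous (fiberCoord σ) := continuous_snd (X := Y) (Y := G)

theorem continuous_fiberRetraction (y : Y) : Continuous (fiberRetraction σ y) :=
  (continuous_const.prodMk (continuous_fiberCoord σ)).subtype_mk _

theorem proj_smul (s : Γ) (x : SkewProduct σ) : proj σ (s • x) = s • proj σ x := rfl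

theorem fiberCoord_smul (s : Γ) (x : SkewProduct σ) :
    fiberCoord σ (s • x) = σ.toFun s (proj σ x) * s • fiberCoord σ x := rfl

-- With `Φ ((z, h), b) = (z, h * b)`, the point `s (z, g)` equals
-- `Φ ((s z, σ(s, z) σ(s, y)⁻¹), σ(s, y) * s g)`, whose last coordinate is that of `s (y, g)`. The
-- fibre over `y` therefore controls `s (z, g)` up to the position of `(s z, σ(s, z) σ(s, y)⁻¹)`.
theorem exists_refines_joinCover [CompactSpace Y] [CompactSpace G] [IsTopologicalGroup G]
    [ContinuousConstSMul Γ Y] (y : Y) {𝒰 : Set (Set (SkewProduct σ))} (h𝒰 : IsFinOpenCover 𝒰) :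
    ∃ 𝒲 : Set (Set (SkewProduct σ)), IsFinOpenCover 𝒲 ∧
      ∀ T : Finset Γ, ∃ 𝒱 : Set (Set Y), IsFinOpenCover 𝒱 ∧ ∀ T' ⊆ T,
        Refines (join (Set.preimage (proj σ) '' 𝒱) (Set.preimage (fiberRetraction σ y) ''
          restrictCover (joinCover 𝒲 T') (proj σ ⁻¹' {y}))) (joinCover 𝒰 T') := by
  let Φ : (Y × G) × G → SkewProduct σ := fun p => ((p.1.1, p.1.2 * p.2) : Y × G)
  have hΦ : Continuous Φ := by
    change Continuous fun p : (Y × G) × G => (p.1.1, p.1.2 * p.2)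
    fun_prop
  obtain ⟨𝒜, ℬ, h𝒜, hℬ, h𝒜ℬ⟩ :=
    exists_prod_refinement (h𝒰.preimage hΦ).isOpen (h𝒰.preimage hΦ).covers
  let base : Γ → Y → Y × G := fun s z => (s • z, σ.toFun s z * (σ.toFun s y)⁻¹)
  have hbase : ∀ s, Continuous (base s) := fun s => by
    have := σ.continuous_toFun s
    fun_prop
  refine ⟨Set.preimage (fiberCoord σ) '' ℬ, hℬ.preimage (continuous_fiberCoord σ), fun T =>
    ⟨finJoin T fun s => Set.preimage (base s) '' 𝒜, .finJoin fun s _ => h𝒜.preimage (hbase s),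
      fun T' hT' => refines_joinCover_iff.2 fun s hs => ?_⟩⟩
  rintro _ ⟨_, ⟨V, hV, rfl⟩, _, ⟨_, ⟨C, hC, rfl⟩, rfl⟩, rfl⟩
  obtain ⟨_, ⟨A, hA, rfl⟩, hVA⟩ := finJoin_refines (hT' hs) V hV
  obtain ⟨_, ⟨_, ⟨B, hB, rfl⟩, rfl⟩, hCB⟩ := joinCover_refines hs C hC
  obtain ⟨_, ⟨U, hU, rfl⟩, hABU⟩ := h𝒜ℬ A hA B hB
  refine ⟨_, mem_image_of_mem _ hU, fun x ⟨hxV, hxC⟩ => ?_⟩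
  have hsx : s • x = Φ (base s (proj σ x), σ.toFun s y * s • fiberCoord σ x) :=
    Prod.ext (proj_smul σ s x) ((fiberCoord_smul σ s x).trans (by simp [base, Φ]))
  rw [mem_preimage, hsx]
  exact hABU ⟨hVA hxV, hCB hxC⟩

theorem limsup_coverDim_joinCover_le [CompactSpace Y] [R1Space Y] [CompactSpace G]
    [IsTopologicalGroup G] [ContinuousConstSMul Γ Y] [ContinuousConstSMul Γ G]
    {F : ℕ → Finset Γ} (hF : IsFolnerSeq F) (y : Y) {𝒰 : Set (Set (SkewProduct σ))}
    (h𝒰 : IsFinOpenCover 𝒰) {S : ℝ≥0} (hS : mdimOn F (proj σ ⁻¹' {y}) < S) :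
    limsup (fun A : Finset Γ => (coverDim (joinCover 𝒰 A) : ℝ≥0∞) / (A.card : ℝ≥0∞))
      (invariantFilter Γ) ≤ mdim Γ Y + S := by
  classical
  obtain ⟨𝒲, h𝒲, hrefines⟩ := exists_refines_joinCover σ y h𝒰
  obtain ⟨N, hN⟩ := eventually_atTop.1
    (eventually_lt_of_limsup_lt ((limsup_le_mdimOn F _ h𝒲).trans_lt hS))
  refine MeanDim.limsup_coverDim_joinCover_le hF (continuous_proj σ) (proj_smul σ) h𝒰
    (N := N) fun I hI => ?_
  obtain ⟨𝒱, h𝒱, h𝒱𝒲⟩ := hrefines (I.biUnion F)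
  refine ⟨𝒱, fun n => Set.preimage (fiberRetraction σ y) ''
    restrictCover (joinCover 𝒲 (F n)) (proj σ ⁻¹' {y}), h𝒱,
    fun n hn => ⟨?_, h𝒱𝒲 _ (Finset.subset_biUnion_of_mem F hn)⟩⟩
  have hcard : ((F n).card : ℝ≥0∞) ≠ 0 := by simpa using (hF.nonempty n).ne_empty
  calc (coverDim (Set.preimage (fiberRetraction σ y) ''
        restrictCover (joinCover 𝒲 (F n)) (proj σ ⁻¹' {y})) : ℝ≥0∞)
      ≤ coverDim (restrictCover (joinCover 𝒲 (F n)) (proj σ ⁻¹' {y})) := by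
        gcongr
        exact coverDim_preimage_le (continuous_fiberRetraction σ y) _
    _ ≤ S * (F n).card :=
        (ENNReal.div_le_iff hcard (ENNReal.natCast_ne_top _)).1 (hN n (hI n hn)).le

end SkewProduct

end MeanDim

open MeanDim in
theorem mainTheorem10_general {Γ Y G : Type*} [Group Γ]
    [TopologicalSpace Y] [CompactSpace Y] [R1Space Y]
    [MulAction Γ Y] [ContinuousConstSMul Γ Y]
    [Group G] [TopologicalSpace G] [IsTopologicalGroup G] [CompactSpace G]
    [MulDistribMulAction Γ G] [ContinuousConstSMul Γ G]
    (σ : Cocycle Γ Y G) (F : ℕ → Finset Γ) (hF : IsFolnerSeq F) (y : Y) :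
    mdim Γ (SkewProduct σ) ≤ mdim Γ Y + mdimOn F (SkewProduct.proj σ ⁻¹' {y}) := by
  rcases eq_or_ne (mdimOn F (SkewProduct.proj σ ⁻¹' {y})) ⊤ with htop | htop
  · simp only [htop, add_top, le_top]
  · refine iSup₂_le fun 𝒰 h𝒰 => ENNReal.le_of_forall_pos_le_add fun ε hε _ => ?_
    lift mdimOn F (SkewProduct.proj σ ⁻¹' {y}) to NNReal using htop with S hS
    rw [add_assoc, ← ENNReal.coe_add]
    refine SkewProduct.limsup_coverDim_joinCover_le σ hF y h𝒰 ?_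
    rw [← hS]
    exact_mod_cast lt_add_of_pos_right S hε

theorem mainTheorem10 {Γ Y G : Type*} [Group Γ] [Countable Γ] (hΓ : MeanDim.IsAmenable Γ)
    [TopologicalSpace Y] [CompactSpace Y] [TopologicalSpace.MetrizableSpace Y]
    [MulAction Γ Y] [ContinuousConstSMul Γ Y]
    [Group G] [TopologicalSpace G] [IsTopologicalGroup G] [CompactSpace G]
    [TopologicalSpace.MetrizableSpace G]
    [MulDistribMulAction Γ G] [ContinuousConstSMul Γ G]
    (σ : MeanDim.Cocycle Γ Y G)
    (F : ℕ → Finset Γ) (hF : MeanDim.IsFolnerSeq F) :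
    MeanDim.mdim Γ (MeanDim.SkewProduct σ) ≤
      MeanDim.mdim Γ Y +
        ⨆ y : Y, MeanDim.mdimOn F (MeanDim.SkewProduct.proj σ ⁻¹' {y}) := by
  rcases isEmpty_or_nonempty Y with hY | ⟨⟨y⟩⟩
  · have : IsEmpty (MeanDim.SkewProduct σ) := ⟨fun p => hY.false (MeanDim.SkewProduct.proj σ p)⟩
    rw [MeanDim.mdim_eq_zero_of_isEmpty]
    exact zero_le
  · refine (mainTheorem10_general σ F hF y).trans ?_
    gcongr
    exact le_iSup (fun y => MeanDim.mdimOn F (MeanDim.SkewProduct.proj σ ⁻¹' {y})) y
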